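/- Let $N\ge 3$, and let $\mathcal C=(O,R)$ and $\mathcal C'=(O',r)$ be two nested circles in the Euclidean plane: $r>0$ and $|OO'|+r<R$. Let $\mathcal B$ be the bicentric (Poncelet) family of all $N$-gons $P=(P_1,\dots,P_N)$ (indices modulo $N$) with vertices on $\mathcal C$, with every side line $P_iP_{i+1}$ tangent to $\mathcal C'$, and with $P_{i+1}\ne P_i$, $P_{i+2}\ne P_i$ for all $i$ (star polygons are allowed). For $P\in\mathcal B$ let $d_i$ be the signed perpendicular distance from $O$ to the line $P_iP_{i+1}$, positive if $O$ and $O'$ lie on the same side of this line and negative if they lie on opposite sides. The polar polygon of $P$ with respect to $\mathcal C$ is bounded by the tangents to $\mathcal C$ at the vertices of $P$; its vertex $Q_i$ is the intersection of the tangents at $P_i$ and $P_{i+1}$, i.e. the pole of $P_iP_{i+1}$ (it is at infinity if $d_i=0$). Each $P\in\mathcal B$ turns around $O'$ in one sense along all its sides; orient the plane so that this sense is counterclockwise, and direct the tangents of $\mathcal C$ by the counterclockwise sense of $\mathcal C$. Let $\theta_i\in(-\pi,\pi]$ be the directed angle of the polar polygon at $Q_i$, from the direction of the tangent at $P_{i+1}$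 to the opposite of the direction of the tangent at $P_i$. Then there is a constant $c$, depending only on $N$, $\mathcal C$, $\mathcal C'$, such that for every $P\in\mathcal B$ $$\sum_{i}\sin\frac{\theta_i}{2}=\frac1R\sum_i d_i=c .$$ In terms of the undirected angles $\varphi_i=\angle Q_{i-1}Q_iQ_{i+1}\in[0,\pi]$ of the polar polygon, when all $Q_i$ are finite: 1. if all $d_i>0$, then $\sum_i\sin(\varphi_i/2)=c$; 2. if $P$ is convex (for each side, all other vertices lie strictly on the same side of its line as $O'$) and $d_k<0$ for some $k$, then $$\sum_{i\ne k-1,k,k+1}\sin\frac{\varphi_i}{2}+\cos\frac{\varphi_{k-1}}{2}-\sin\frac{\varphi_k}{2}+\cos\frac{\varphi_{k+1}}{2}=c .$$ The parabola-inscribed family is the special case where $O$ lies on $\mathcal C'$: if $|OO'|=r$, then an $N$-gon $P$ inscribed in $\mathcal C$ (with $P_{i+1}\neq P_i$, $P_{i+2}\ne P_i$) whose polar polygon has finite vertices $Q_i$ belongs to $\mathcal B$ if and only if all $Q_i$ lie on the parabola with focus $O$ whose directrix is the polar line $\{X:\langle X-O,\,O'-O\rangle=R^2\}$ of $O'$ with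 respect to $\mathcal C$. -/

import Mathlib

/-! The Euclidean plane is `ℂ` with its real inner product. An `N`-gon is given by its cyclically
ordered vertices `P : ZMod N → ℂ`, with sides on the lines through `P i` and `P (i + 1)`. -/

noncomputable section

namespace Bicentric

open EuclideanGeometry

attribute [local instance] Complex.finrank_real_complex_fact

/-- An `N`-gon inscribed in the circle `C`: every vertex lies on `C`, adjacent vertices are
distinct, and so are the lines carrying two adjacent sides (the polygon does not turn back along
the side it has just traversed). Self-intersecting (star) polygons are allowed. -/
structure IsInscribed {N : ℕ} (C : Sphere ℂ) (P : ZMod N → ℂ) : Prop where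
  mem : ∀ i, P i ∈ C
  ne : ∀ i, P (i + 1) ≠ P i
  no_backtrack : ∀ i, P (i + 2) ≠ P i

/-- A member of the bicentric (Poncelet) family of `N`-gons of the circles `C` and `C'`: it is
inscribed in `C`, and the line of each side is tangent to `C'`. -/
structure IsBicentric {N : ℕ} (C C' : Sphere ℂ) (P : ZMod N → ℂ) : Prop
    extends IsInscribed C P where
  tangent : ∀ i, C'.IsTangent line[ℝ, P i, P (i + 1)]

/-- The signed distance `d i` from the circumcenter (the center of `C`) to the line of the `i`-th
side: the perpendicular distance, counted positively when the circumcenter lies on the same side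
of that line as the incenter (the center of `C'`), negatively when it lies on the other side. -/
def sideDist {N : ℕ} (C C' : Sphere ℂ) (P : ZMod N → ℂ) (i : ZMod N) : ℝ :=
  (line[ℝ, P i, P (i + 1)]).signedInfDist C'.center C.center

/-- `Q` is the polar polygon of `P` with respect to the circle `C`: it is bounded by the tangents
to `C` at the vertices of `P`. Its vertex `Q i` is the common point of the tangents at `P i` and
`P (i + 1)`, that is, the pole of the `i`-th side of `P`. -/
def IsPolarPolygon {N : ℕ} (C : Sphere ℂ) (P Q : ZMod N → ℂ) : Prop :=
  ∀ i, Q i ∈ C.orthRadius (P i) ∧ Q i ∈ C.orthRadius (P (i + 1))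

/-- With respect to the orientation `o` of the plane, `P` turns counterclockwise around the center
of `C'` along each side. -/
def IsCounterclockwise {N : ℕ} (o : Orientation ℝ ℂ (Fin 2)) (C' : Sphere ℂ) (P : ZMod N → ℂ) :
    Prop :=
  ∀ i, 0 < o.areaForm (P i - C'.center) (P (i + 1) - C'.center)

/-- The direction of the tangent to `C` at `X`, when `C` is traversed counterclockwise for the
orientation `o`. -/
def tangentDir (o : Orientation ℝ ℂ (Fin 2)) (C : Sphere ℂ) (X : ℂ) : ℂ :=
  o.rightAngleRotation (X - C.center)

/-- The directed angle `θ i ∈ (-π, π]` at the `i`-th vertex of the polar polygon of `P` with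
respect to `C`. The sides of the polar polygon lie on the tangents to `C` at the vertices of `P`,
and each is directed by the counterclockwise sense of `C`; `θ i` is the angle from the outgoing side
(on the tangent at `P (i + 1)`) to the reversed incoming side (on the tangent at `P i`). -/
def directedAngle {N : ℕ} (o : Orientation ℝ ℂ (Fin 2)) (C : Sphere ℂ) (P : ZMod N → ℂ)
    (i : ZMod N) : ℝ :=
  (o.oangle (tangentDir o C (P (i + 1))) (-tangentDir o C (P i))).toReal

/-- The undirected geometric angle, in `[0, π]`, of the polygon `Q` at its vertex `Q i`. -/
def vertexAngle {N : ℕ} (Q : ZMod N → ℂ) (i : ZMod N) : ℝ :=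
  ∠ (Q (i - 1)) (Q i) (Q (i + 1))

/-- The polygon `P` around `C'` is convex: all vertices off a side lie strictly on the same side
of its line as the center of `C'`. -/
def IsConvexAround {N : ℕ} (C' : Sphere ℂ) (P : ZMod N → ℂ) : Prop :=
  ∀ i j, j ≠ i → j ≠ i + 1 → (line[ℝ, P i, P (i + 1)]).SSameSide C'.center (P j)

/-- The polar line of the point `X` with respect to the circle `C` (for `X ≠ C.center`). -/
def polarLine (C : Sphere ℂ) (X : ℂ) : Set ℂ :=
  {x | inner ℝ (x - C.center) (X - C.center) = C.radius ^ 2}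

/-- The parabola with focus `F` and directrix `D`. -/
def parabola (F : ℂ) (D : Set ℂ) : Set ℂ :=
  {x | dist x F = Metric.infDist x D}

end Bicentric

end

noncomputable section

namespace Bicentric

open Real intervalIntegral EuclideanGeometry

attribute [local instance] Complex.finrank_real_complex_fact

/-! Measure polar angles from the direction of `O'`, and put `δ = |OO'|`. The chord touching the
inner circle at polar angle `β` has endpoints at `β ± κ` on the outer circle, where `R cos κ = r + δ
cos β`; this is also its signed distance from `O`. Each endpoint moves at the speed `t / (R sin κ)`,
with `t` the tangent length from that endpoint (`hasDerivAt_endpoint`). Since the denominator is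
common to both endpoints, two integrals over the arc from `β - κ` to `β + κ` are controlled: `∫ 1/t`
does not depend on `β`, and neither does `R cos κ + (1/4) ∫ t`.

In a closed polygon the arcs fit together, so both integrals add up to a whole number of turns times
the integral over a period. The first identity fixes that number from `N` and the circles alone; the
second then fixes `∑ R cos κ i` (`exists_sum_cos_halfAngle`). Star polygons need no separate
treatment.

The rest is translation. No backtracking forces one sense `ε` along all sides. The directed angle of
the polar polygon is `π - 2κ`, whose half has sine `cos κ`. Undirected angles only see `|cos κ|` and
may be replaced by their supplements; signs of sums of consecutive tangents decide which
(`vertexAngle_eq`), and convexity determines these signs. The parabola statement is Salmon's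
reciprocity for poles and polars. -/

/-- Half of the central angle of the chord of a circle of radius `R` that touches the circle of
radius `r` at the polar angle `β`, when the centers are at distance `δ` (in the direction `0`). -/
def halfAngle (R r δ β : ℝ) : ℝ := arccos ((r + δ * cos β) / R)

/-- The length of the tangent from the point of the outer circle at the polar angle `φ` to the
inner circle. -/
def tangentLength (R r δ φ : ℝ) : ℝ := √(R ^ 2 + δ ^ 2 - r ^ 2 - 2 * R * δ * cos φ)

/-! ### Calculus of the chords touching the inner circle. -/

section Chords

variable {R r δ : ℝ}

lemma abs_ratio_lt_one (hr : 0 < r) (hδ : 0 ≤ δ) (h : δ + r < R) (β : ℝ) :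
    -1 < (r + δ * cos β) / R ∧ (r + δ * cos β) / R < 1 := by
  have hR : 0 < R := by linarith
  constructor
  · rw [lt_div_iff₀ hR]; nlinarith [neg_one_le_cos β]
  · rw [div_lt_iff₀ hR]; nlinarith [cos_le_one β]

lemma radius_mul_cos_halfAngle (hr : 0 < r) (hδ : 0 ≤ δ) (h : δ + r < R) (β : ℝ) :
    R * cos (halfAngle R r δ β) = r + δ * cos β := by
  have hb := abs_ratio_lt_one hr hδ h β
  have hR : R ≠ 0 := by linarith
  rw [halfAngle, cos_arccos hb.1.le hb.2.le]
  field_simp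

lemma halfAngle_pos (hr : 0 < r) (hδ : 0 ≤ δ) (h : δ + r < R) (β : ℝ) :
    0 < halfAngle R r δ β :=
  arccos_pos.2 (abs_ratio_lt_one hr hδ h β).2

lemma halfAngle_lt_pi (hr : 0 < r) (hδ : 0 ≤ δ) (h : δ + r < R) (β : ℝ) :
    halfAngle R r δ β < π :=
  lt_of_le_of_ne (arccos_le_pi _)
    fun h' => (abs_ratio_lt_one hr hδ h β).1.not_ge (arccos_eq_pi.1 h')

lemma sin_halfAngle_pos (hr : 0 < r) (hδ : 0 ≤ δ) (h : δ + r < R) (β : ℝ) :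
    0 < sin (halfAngle R r δ β) :=
  sin_pos_of_pos_of_lt_pi (halfAngle_pos hr hδ h β) (halfAngle_lt_pi hr hδ h β)

lemma halfAngle_add_int_mul_two_pi (β : ℝ) (m : ℤ) :
    halfAngle R r δ (β + m * (2 * π)) = halfAngle R r δ β := by
  rw [halfAngle, halfAngle, cos_add_int_mul_two_pi]

/-- The left side is the distance from the midpoint of the chord to the tangency point, the right
side is the half chord: the chord touches the inner circle strictly between its endpoints. -/
lemma abs_mul_sin_lt (hr : 0 < r) (hδ : 0 ≤ δ) (h : δ + r < R) (β : ℝ) :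
    |δ * sin β| < R * sin (halfAngle R r δ β) := by
  have hR : 0 < R := by linarith
  have hs := sin_halfAngle_pos hr hδ h β
  refine abs_lt_of_sq_lt_sq ?_ (by positivity)
  have h1 := radius_mul_cos_halfAngle hr hδ h β
  have h2 : (R * sin (halfAngle R r δ β)) ^ 2 = R ^ 2 - (r + δ * cos β) ^ 2 := by
    rw [← h1, mul_pow, sin_sq]; ring
  rw [h2, mul_pow, sin_sq]
  nlinarith [mul_nonneg (mul_nonneg hr.le hδ) (sub_nonneg.2 (cos_le_one β))]

/-- The tangency point splits the chord into the two tangent lengths: half the chord plus or minus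
the offset of the tangency point from the midpoint. `abs_mul_sin_lt` settles the sign of the square
root. -/
lemma tangentLength_eq (hr : 0 < r) (hδ : 0 ≤ δ) (h : δ + r < R) (β ε : ℝ) (hε : ε = 1 ∨ ε = -1) :
    tangentLength R r δ (β + ε * halfAngle R r δ β)
      = R * sin (halfAngle R r δ β) + ε * (δ * sin β) := by
  have h1 := radius_mul_cos_halfAngle hr hδ h β
  have h2 := abs_lt.1 (abs_mul_sin_lt hr hδ h β)
  have h3 := sin_sq_add_cos_sq (halfAngle R r δ β)
  have h4 := sin_sq_add_cos_sq β
  have h5 : 0 ≤ R * sin (halfAngle R r δ β) + ε * (δ * sin β) := by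
    rcases hε with rfl | rfl <;> linarith
  have h6 : R ^ 2 + δ ^ 2 - r ^ 2 - 2 * R * δ * cos (β + ε * halfAngle R r δ β)
      = (R * sin (halfAngle R r δ β) + ε * (δ * sin β)) ^ 2 := by
    have h7 : cos (β + ε * halfAngle R r δ β)
        = cos β * cos (halfAngle R r δ β) - ε * sin β * sin (halfAngle R r δ β) := by
      rcases hε with rfl | rfl <;> simp [cos_add]
    have h8 : ε ^ 2 = 1 := by rcases hε with rfl | rfl <;> norm_num
    rw [h7]
    linear_combination (R * cos (halfAngle R r δ β) - δ * cos β + r) * h1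
      - R ^ 2 * h3 - δ ^ 2 * h4 - δ ^ 2 * sin β ^ 2 * h8
  rw [tangentLength, h6, sqrt_sq h5]

lemma tangentLength_pos (hr : 0 < r) (hδ : 0 ≤ δ) (h : δ + r < R) (φ : ℝ) :
    0 < tangentLength R r δ φ := by
  have hR : 0 < R := by linarith
  refine sqrt_pos.2 ?_
  nlinarith [mul_nonneg (mul_nonneg hR.le hδ) (sub_nonneg.2 (cos_le_one φ))]

lemma continuous_tangentLength : Continuous (tangentLength R r δ) := by
  unfold tangentLength
  fun_prop

lemma periodic_tangentLength : Function.Periodic (tangentLength R r δ) (2 * π) := fun φ => by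
  rw [tangentLength, tangentLength, cos_add_two_pi]

lemma hasDerivAt_halfAngle (hr : 0 < r) (hδ : 0 ≤ δ) (h : δ + r < R) (β : ℝ) :
    HasDerivAt (halfAngle R r δ) (δ * sin β / (R * sin (halfAngle R r δ β))) β := by
  have hb := abs_ratio_lt_one hr hδ h β
  have hx : HasDerivAt (fun β => (r + δ * cos β) / R) (δ * -sin β / R) β :=
    (((hasDerivAt_cos β).const_mul δ).const_add r).div_const R
  have h1 := (hasDerivAt_arccos hb.1.ne' hb.2.ne).comp β hx
  rw [← sin_arccos] at h1
  have h2 : -(1 / sin (arccos ((r + δ * cos β) / R))) * (δ * -sin β / R)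
      = δ * sin β / (R * sin (halfAngle R r δ β)) := by
    rw [halfAngle, mul_comm R, neg_mul, div_mul_div_comm]
    ring
  rwa [h2] at h1

/-- The numerator depends only on the endpoint and the denominator only on the chord; both integral
identities rest on this separation. -/
lemma hasDerivAt_endpoint (hr : 0 < r) (hδ : 0 ≤ δ) (h : δ + r < R) (β ε : ℝ)
    (hε : ε = 1 ∨ ε = -1) :
    HasDerivAt (fun β => β + ε * halfAngle R r δ β)
      (tangentLength R r δ (β + ε * halfAngle R r δ β) / (R * sin (halfAngle R r δ β))) β := by
  have hR : R ≠ 0 := by linarith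
  have hs := (sin_halfAngle_pos hr hδ h β).ne'
  convert! (hasDerivAt_id β).add ((hasDerivAt_halfAngle hr hδ h β).const_mul ε) using 1
  rw [tangentLength_eq hr hδ h β ε hε]
  field_simp

lemma strictMono_endpoint (hr : 0 < r) (hδ : 0 ≤ δ) (h : δ + r < R) (ε : ℝ)
    (hε : ε = 1 ∨ ε = -1) : StrictMono fun β => β + ε * halfAngle R r δ β := by
  refine strictMono_of_deriv_pos fun β => ?_
  rw [(hasDerivAt_endpoint hr hδ h β ε hε).deriv]
  exact div_pos (tangentLength_pos hr hδ h _)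
    (mul_pos (by linarith) (sin_halfAngle_pos hr hδ h β))

/-- The chord touching the inner circle is determined by its first (or last) endpoint. -/
lemma eq_add_int_mul_two_pi_of_endpoint (hr : 0 < r) (hδ : 0 ≤ δ) (h : δ + r < R) {ε : ℝ}
    (hε : ε = 1 ∨ ε = -1) {β γ : ℝ} {m : ℤ}
    (he : γ + ε * halfAngle R r δ γ = β + ε * halfAngle R r δ β + m * (2 * π)) :
    γ = β + m * (2 * π) := by
  refine (strictMono_endpoint hr hδ h ε hε).injective ?_
  simp only [halfAngle_add_int_mul_two_pi, he]
  ring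

lemma hasDerivAt_integral_endpoint {f : ℝ → ℝ} (hf : Continuous f) (hr : 0 < r) (hδ : 0 ≤ δ)
    (h : δ + r < R) (β ε : ℝ) (hε : ε = 1 ∨ ε = -1) :
    HasDerivAt (fun β => ∫ φ in (0 : ℝ)..(β + ε * halfAngle R r δ β), f φ)
      (f (β + ε * halfAngle R r δ β) * (tangentLength R r δ (β + ε * halfAngle R r δ β) /
        (R * sin (halfAngle R r δ β)))) β :=
  ((hf.integral_hasStrictDerivAt 0 _).hasDerivAt).comp β (hasDerivAt_endpoint hr hδ h β ε hε)

/-- The chords touching the inner circle cut off arcs of equal measure for the density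
`1 / tangentLength` (Jacobi, Bertrand). -/
lemma exists_integral_inv_tangentLength (hr : 0 < r) (hδ : 0 ≤ δ) (h : δ + r < R) :
    ∃ α : ℝ, ∀ β, ∀ ε : ℝ, ε = 1 ∨ ε = -1 →
      (∫ φ in (0 : ℝ)..(β + ε * halfAngle R r δ β), (tangentLength R r δ φ)⁻¹)
      - (∫ φ in (0 : ℝ)..(β - ε * halfAngle R r δ β), (tangentLength R r δ φ)⁻¹) = ε * α := by
  have hc : Continuous fun φ => (tangentLength R r δ φ)⁻¹ :=
    continuous_tangentLength.inv₀ fun φ => (tangentLength_pos hr hδ h φ).ne'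
  have hd : ∀ β, HasDerivAt (fun β =>
      (∫ φ in (0 : ℝ)..(β + 1 * halfAngle R r δ β), (tangentLength R r δ φ)⁻¹)
      - (∫ φ in (0 : ℝ)..(β + (-1) * halfAngle R r δ β), (tangentLength R r δ φ)⁻¹)) 0 β := by
    intro β
    convert! (hasDerivAt_integral_endpoint hc hr hδ h β 1 (.inl rfl)).sub
      (hasDerivAt_integral_endpoint hc hr hδ h β (-1) (.inr rfl)) using 1
    have h1 := (tangentLength_pos hr hδ h (β + 1 * halfAngle R r δ β)).ne'
    have h2 := (tangentLength_pos hr hδ h (β + (-1) * halfAngle R r δ β)).ne'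
    -- Against the density `1/t` both endpoints contribute `1 / (R sin κ)`, so the contributions
    -- cancel.
    rw [← mul_div_assoc, ← mul_div_assoc, inv_mul_cancel₀ h1, inv_mul_cancel₀ h2, sub_self]
  have hconst := is_const_of_deriv_eq_zero (fun β => (hd β).differentiableAt)
    (fun β => (hd β).deriv)
  obtain ⟨α, hα⟩ : ∃ α : ℝ, ∀ β,
      (∫ φ in (0 : ℝ)..(β + 1 * halfAngle R r δ β), (tangentLength R r δ φ)⁻¹)
      - (∫ φ in (0 : ℝ)..(β + (-1) * halfAngle R r δ β), (tangentLength R r δ φ)⁻¹) = α :=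
    ⟨_, fun β => hconst β 0⟩
  refine ⟨α, fun β ε hε => ?_⟩
  rw [← hα β]
  rcases hε with rfl | rfl <;> simp only [neg_mul, one_mul, sub_neg_eq_add, ← sub_eq_add_neg,
    neg_sub]

/-- The arc cut off by a chord touching the inner circle has, for the density `tangentLength`, the
measure given by the distance of the chord from the center (Graves). -/
lemma exists_integral_tangentLength (hr : 0 < r) (hδ : 0 ≤ δ) (h : δ + r < R) :
    ∃ K : ℝ, ∀ β, ∀ ε : ℝ, ε = 1 ∨ ε = -1 →
      R * cos (halfAngle R r δ β) + ε / 4 *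
      ((∫ φ in (0 : ℝ)..(β + ε * halfAngle R r δ β), tangentLength R r δ φ)
      - (∫ φ in (0 : ℝ)..(β - ε * halfAngle R r δ β), tangentLength R r δ φ)) = K := by
  have hd : ∀ β, HasDerivAt (fun β => (r + δ * cos β) + 1 / 4 *
      ((∫ φ in (0 : ℝ)..(β + 1 * halfAngle R r δ β), tangentLength R r δ φ)
      - (∫ φ in (0 : ℝ)..(β + (-1) * halfAngle R r δ β), tangentLength R r δ φ))) 0 β := by
    intro β
    convert! (((hasDerivAt_cos β).const_mul δ).const_add r).add
      (((hasDerivAt_integral_endpoint continuous_tangentLength hr hδ h β 1 (.inl rfl)).sub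
      (hasDerivAt_integral_endpoint continuous_tangentLength hr hδ h β (-1)
        (.inr rfl))).const_mul (1 / 4)) using 1
    have hR : R ≠ 0 := by linarith
    have hs := (sin_halfAngle_pos hr hδ h β).ne'
    -- The two tangent lengths have difference of squares `4 R δ sin κ sin β`; after division by `4
    -- R sin κ` it cancels the derivative `-δ sin β` of the distance.
    rw [tangentLength_eq hr hδ h β 1 (.inl rfl), tangentLength_eq hr hδ h β (-1) (.inr rfl)]
    field_simp
    ring
  have hconst := is_const_of_deriv_eq_zero (fun β => (hd β).differentiableAt)
    (fun β => (hd β).deriv)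
  obtain ⟨K, hK⟩ : ∃ K : ℝ, ∀ β, (r + δ * cos β) + 1 / 4 *
      ((∫ φ in (0 : ℝ)..(β + 1 * halfAngle R r δ β), tangentLength R r δ φ)
      - (∫ φ in (0 : ℝ)..(β + (-1) * halfAngle R r δ β), tangentLength R r δ φ)) = K :=
    ⟨_, fun β => hconst β 0⟩
  refine ⟨K, fun β ε hε => ?_⟩
  rw [← hK β, radius_mul_cos_halfAngle hr hδ h]
  rcases hε with rfl | rfl <;> simp only [neg_mul, one_mul, sub_neg_eq_add, ← sub_eq_add_neg]
  ring

lemma integral_add_int_mul_period {f : ℝ → ℝ} (hf : Continuous f) {T : ℝ}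
    (hp : Function.Periodic f T) (φ : ℝ) (m : ℤ) :
    ∫ x in (0 : ℝ)..(φ + m * T), f x = (∫ x in (0 : ℝ)..φ, f x) + m * ∫ x in (0 : ℝ)..T, f x := by
  have h1 := hp.intervalIntegral_add_zsmul_eq m φ fun _ _ => hf.intervalIntegrable _ _
  rw [hp.intervalIntegral_add_eq φ 0, zero_add, zsmul_eq_mul, zsmul_eq_mul] at h1
  rw [← h1, integral_add_adjacent_intervals] <;> exact hf.intervalIntegrable _ _

/-- For closed polygons circumscribed about the inner circle and inscribed in the outer one, the sum
of the signed distances of the sides from the center of the outer circle is constant. -/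
lemma exists_sum_cos_halfAngle {N : ℕ} [NeZero N] (hr : 0 < r) (hδ : 0 ≤ δ) (h : δ + r < R) :
    ∃ c : ℝ, ∀ ε : ℝ, ε = 1 ∨ ε = -1 → ∀ β : ZMod N → ℝ,
      (∀ i, ∃ m : ℤ, β i + ε * halfAngle R r δ (β i)
        = β (i + 1) - ε * halfAngle R r δ (β (i + 1)) + m * (2 * π)) →
      ∑ i, cos (halfAngle R r δ (β i)) = c := by
  obtain ⟨α, hα⟩ := exists_integral_inv_tangentLength hr hδ h
  obtain ⟨K, hK⟩ := exists_integral_tangentLength hr hδ h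
  have hR : R ≠ 0 := by linarith
  have hc : Continuous fun φ => (tangentLength R r δ φ)⁻¹ :=
    continuous_tangentLength.inv₀ fun φ => (tangentLength_pos hr hδ h φ).ne'
  set L := ∫ φ in (0 : ℝ)..(2 * π), (tangentLength R r δ φ)⁻¹ with hL
  set E := ∫ φ in (0 : ℝ)..(2 * π), tangentLength R r δ φ
  have hL0 : L ≠ 0 := (intervalIntegral_pos_of_pos_on (hc.intervalIntegrable _ _)
    (fun φ _ => inv_pos.2 (tangentLength_pos hr hδ h φ)) two_pi_pos).ne'
  refine ⟨(N * K - N * α / L * E / 4) / R, fun ε hε β hβ => ?_⟩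
  choose m hm using hβ
  have hε2 : ε * ε = 1 := by rcases hε with rfl | rfl <;> norm_num
  -- For any periodic density the arcs telescope cyclically, up to the `m i` full turns spent at the
  -- vertices.
  have key : ∀ f : ℝ → ℝ, Continuous f → Function.Periodic f (2 * π) →
      ∑ i, ((∫ φ in (0 : ℝ)..(β i + ε * halfAngle R r δ (β i)), f φ)
        - ∫ φ in (0 : ℝ)..(β i - ε * halfAngle R r δ (β i)), f φ)
      = (∑ i, (m i : ℝ)) * ∫ φ in (0 : ℝ)..(2 * π), f φ := by
    intro f hf hp
    have h1 : ∀ i, (∫ φ in (0 : ℝ)..(β i + ε * halfAngle R r δ (β i)), f φ)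
        = (∫ φ in (0 : ℝ)..(β (i + 1) - ε * halfAngle R r δ (β (i + 1))), f φ)
          + m i * ∫ φ in (0 : ℝ)..(2 * π), f φ := fun i => by
      rw [hm i, integral_add_int_mul_period hf hp]
    have h2 := Equiv.sum_comp (Equiv.addRight (1 : ZMod N))
      fun i => ∫ φ in (0 : ℝ)..(β i - ε * halfAngle R r δ (β i)), f φ
    simp only [Equiv.coe_addRight] at h2
    rw [Finset.sum_sub_distrib, Finset.sum_congr rfl fun i _ => h1 i, Finset.sum_add_distrib, h2,
      Finset.sum_mul]
    ring
  have h1 := key _ hc (periodic_tangentLength.comp (·⁻¹))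
  have h2 := key (tangentLength R r δ) continuous_tangentLength periodic_tangentLength
  simp only [hα _ ε hε, Finset.sum_const, Finset.card_univ, ZMod.card, nsmul_eq_mul, ← hL] at h1
  have h3 : ∑ i, R * cos (halfAngle R r δ (β i)) = N * K - ε / 4 * ((∑ i, (m i : ℝ)) * E) := by
    rw [← h2, Finset.mul_sum, eq_sub_iff_add_eq, ← Finset.sum_add_distrib]
    simp only [hK _ ε hε, Finset.sum_const, Finset.card_univ, ZMod.card, nsmul_eq_mul]
  rw [eq_div_iff hR, mul_comm, Finset.mul_sum, h3]
  -- The total number of turns is forced, so the sum does not depend on the polygon. Reversing the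
  -- sense changes its sign, which the factor `ε` in `h3` absorbs.
  have h4 : (∑ i, (m i : ℝ)) = N * (ε * α) / L := by
    rw [eq_div_iff hL0, h1]
  rw [h4]
  linear_combination (-(N * α * E / L / 4)) * hε2

end Chords

/-! ### Polar coordinates on the two circles. -/

lemma eq_neg_of_ne_of_sign {a b : ℝ} (ha : a = 1 ∨ a = -1) (hb : b = 1 ∨ b = -1) (h : a ≠ b) :
    a = -b := by
  grind

lemma inner_circleMap (a b x y : ℝ) :
    inner ℝ (circleMap 0 a x) (circleMap 0 b y) = a * b * cos (y - x) := by
  rw [Complex.inner, Complex.mul_re, Complex.conj_re, Complex.conj_im]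
  simp only [circleMap_zero_re, circleMap_zero_im, cos_sub]
  ring

lemma circleMap_add_int_mul_two_pi (c : ℂ) (R x : ℝ) (m : ℤ) :
    circleMap c R (x + m * (2 * π)) = circleMap c R x := by
  simpa using (periodic_circleMap c R).int_mul m x

lemma exists_circleMap_eq {C : Sphere ℂ} {X : ℂ} (hX : X ∈ C) (ω : ℝ) :
    ∃ φ : ℝ, X = circleMap C.center C.radius (ω + φ) := by
  refine ⟨(X - C.center).arg - ω, ?_⟩
  rw [mem_sphere, dist_eq_norm] at hX
  rw [circleMap, add_sub_cancel, ← hX, Complex.norm_mul_exp_arg_mul_I, add_sub_cancel]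

lemma exists_center_eq_circleMap (C C' : Sphere ℂ) :
    ∃ ω : ℝ, C'.center = circleMap C.center (dist C.center C'.center) ω := by
  refine ⟨(C'.center - C.center).arg, ?_⟩
  rw [circleMap, dist_comm, dist_eq_norm, Complex.norm_mul_exp_arg_mul_I, add_sub_cancel]

/-- The half central angle of the chord of `C` that touches `C'` at the polar angle `β`, measured
from the direction of the center of `C'`. -/
def chordAngle (C C' : Sphere ℂ) (β : ℝ) : ℝ :=
  halfAngle C.radius C'.radius (dist C.center C'.center) β

/-- The sides of `P` touch `C'` at the polar angles `β i`, measured from the direction `ω` of the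
center of `C'`, and `P` is traversed in the sense `ε`. -/
structure HasTangencyAngles {N : ℕ} (C C' : Sphere ℂ) (ω ε : ℝ) (P : ZMod N → ℂ)
    (β : ZMod N → ℝ) : Prop where
  center_eq : C'.center = circleMap C.center (dist C.center C'.center) ω
  sign : ε = 1 ∨ ε = -1
  start_eq : ∀ i, P i = circleMap C.center C.radius (ω + (β i - ε * chordAngle C C' (β i)))
  end_eq : ∀ i, P (i + 1) = circleMap C.center C.radius (ω + (β i + ε * chordAngle C C' (β i)))
  tangentAt : ∀ i, C'.IsTangentAt (circleMap C'.center C'.radius (ω + β i)) line[ℝ, P i, P (i + 1)]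

section Sides

variable {C C' : Sphere ℂ} {ω : ℝ}

/-- Zero locates the points of `C` on the tangent line, and the sign tells the side of that line;
both uses recur below. -/
lemma inner_sub_tangencyPoint (hω : C'.center = circleMap C.center (dist C.center C'.center) ω)
    (β φ : ℝ) :
    inner ℝ (circleMap C.center C.radius (ω + φ) - circleMap C'.center C'.radius (ω + β))
      (circleMap C'.center C'.radius (ω + β) - C'.center)
    = C'.radius * (C.radius * cos (φ - β)
      - (C'.radius + dist C.center C'.center * cos β)) := by
  have h1 : circleMap C.center C.radius (ω + φ) - circleMap C'.center C'.radius (ω + β)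
      = circleMap 0 C.radius (ω + φ) - circleMap 0 (dist C.center C'.center) ω
        - circleMap 0 C'.radius (ω + β) := by
    rw [← circleMap_sub_center C.center C.radius, ← circleMap_sub_center C'.center C'.radius,
      ← circleMap_sub_center C.center (dist _ _), ← hω]
    ring
  rw [h1, circleMap_sub_center, inner_sub_left, inner_sub_left, inner_circleMap, inner_circleMap,
    inner_circleMap, ← cos_neg (φ - β)]
  ring_nf
  simp

lemma radius_mul_cos_chordAngle (hr : 0 < C'.radius)
    (hn : dist C.center C'.center + C'.radius < C.radius) (β : ℝ) :
    C.radius * cos (chordAngle C C' β) = C'.radius + dist C.center C'.center * cos β :=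
  radius_mul_cos_halfAngle hr dist_nonneg hn β

lemma sin_chordAngle_pos (hr : 0 < C'.radius)
    (hn : dist C.center C'.center + C'.radius < C.radius) (β : ℝ) :
    0 < sin (chordAngle C C' β) :=
  sin_halfAngle_pos hr dist_nonneg hn β

lemma exists_sign_of_mem_tangent (hω : C'.center = circleMap C.center (dist C.center C'.center) ω)
    (hr : 0 < C'.radius) (hn : dist C.center C'.center + C'.radius < C.radius)
    {s : AffineSubspace ℝ ℂ} {β : ℝ}
    (hs : C'.IsTangentAt (circleMap C'.center C'.radius (ω + β)) s) {X : ℂ} (hX : X ∈ C)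
    (hXs : X ∈ s) :
    ∃ ε : ℝ, (ε = 1 ∨ ε = -1) ∧
      X = circleMap C.center C.radius (ω + (β + ε * chordAngle C C' β)) := by
  obtain ⟨φ, rfl⟩ := exists_circleMap_eq hX ω
  have hR : C.radius ≠ 0 := by linarith [dist_nonneg (x := C.center) (y := C'.center)]
  have h1 := hs.inner_left_eq_zero_of_mem hXs
  rw [vsub_eq_sub, vsub_eq_sub, inner_sub_tangencyPoint hω,
    ← radius_mul_cos_chordAngle hr hn, ← mul_sub] at h1
  have h2 : cos (chordAngle C C' β) = cos (φ - β) := by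
    have := (mul_eq_zero.1 ((mul_eq_zero.1 h1).resolve_left hr.ne')).resolve_left hR
    linarith
  obtain ⟨k, hk | hk⟩ := cos_eq_cos_iff.1 h2
  · refine ⟨1, .inl rfl, ?_⟩
    rw [← circleMap_add_int_mul_two_pi _ _ (ω + (β + 1 * _)) k]
    congr 1; linarith
  · refine ⟨-1, .inr rfl, ?_⟩
    rw [← circleMap_add_int_mul_two_pi _ _ (ω + (β + -1 * _)) k]
    congr 1; linarith

lemma exists_tangencyAngle_of_side
    (hω : C'.center = circleMap C.center (dist C.center C'.center) ω)
    (hr : 0 < C'.radius) (hn : dist C.center C'.center + C'.radius < C.radius)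
    {X Y : ℂ} (hX : X ∈ C) (hY : Y ∈ C) (hXY : Y ≠ X) (hT : C'.IsTangent line[ℝ, X, Y]) :
    ∃ ε β : ℝ, (ε = 1 ∨ ε = -1) ∧
      X = circleMap C.center C.radius (ω + (β - ε * chordAngle C C' β)) ∧
      Y = circleMap C.center C.radius (ω + (β + ε * chordAngle C C' β)) ∧
      C'.IsTangentAt (circleMap C'.center C'.radius (ω + β)) line[ℝ, X, Y] := by
  obtain ⟨T, hT⟩ := hT
  obtain ⟨β, rfl⟩ := exists_circleMap_eq hT.mem_sphere ω
  obtain ⟨ε, hε, h1⟩ := exists_sign_of_mem_tangent hω hr hn hT hX (left_mem_affineSpan_pair ℝ X Y)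
  obtain ⟨ε', hε', h2⟩ :=
    exists_sign_of_mem_tangent hω hr hn hT hY (right_mem_affineSpan_pair ℝ X Y)
  have h3 : ε = -ε' := by
    have : ε ≠ ε' := by rintro rfl; exact hXY (h2.trans h1.symm)
    exact eq_neg_of_ne_of_sign hε hε' this
  refine ⟨ε', β, hε', ?_, h2, hT⟩
  rw [h1, h3, neg_mul, sub_eq_add_neg]

lemma circleMap_eq_circleMap_iff_exists_int {c : ℂ} {R x y : ℝ} (hR : R ≠ 0) :
    circleMap c R x = circleMap c R y ↔ ∃ m : ℤ, x = y + m * (2 * π) := by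
  rw [circleMap_eq_circleMap_iff c hR]
  refine exists_congr fun m => ?_
  rw [← mul_assoc, ← add_mul, mul_left_inj' Complex.I_ne_zero]
  norm_cast

end Sides

/-! ### The common sense of traversal and the signed distances. -/

section Polygons

variable {N : ℕ} {C C' : Sphere ℂ} {P : ZMod N → ℂ}

/-- A bicentric polygon is traversed in one sense along all its sides. -/
lemma IsBicentric.exists_hasTangencyAngles [NeZero N] (hP : IsBicentric C C' P)
    (hr : 0 < C'.radius) (hn : dist C.center C'.center + C'.radius < C.radius) :
    ∃ ω ε β, HasTangencyAngles C C' ω ε P β := by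
  obtain ⟨ω, hω⟩ := exists_center_eq_circleMap C C'
  have hR : C.radius ≠ 0 := by linarith [dist_nonneg (x := C.center) (y := C'.center)]
  choose ε β hε h1 h2 h3 using fun i => exists_tangencyAngle_of_side hω hr hn (hP.mem i)
    (hP.mem (i + 1)) (hP.ne i) (hP.tangent i)
  -- If the sense flipped at a vertex, both sides would have it as the same kind of endpoint, hence
  -- would touch `C'` at the same point, and `P (i + 2)` would equal `P i`.
  have hstep : ∀ i, ε (i + 1) = ε i := by
    intro i
    by_contra hne
    have h4 : ε (i + 1) = -ε i := eq_neg_of_ne_of_sign (hε _) (hε i) hne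
    have h5 := (h2 i).symm.trans (h1 (i + 1))
    rw [h4, circleMap_eq_circleMap_iff_exists_int hR] at h5
    obtain ⟨m, hm⟩ := h5
    have h6 := eq_add_int_mul_two_pi_of_endpoint hr dist_nonneg hn (hε i) (m := m)
      (γ := β i) (β := β (i + 1)) (by simp only [chordAngle] at hm; linarith)
    refine hP.no_backtrack i ?_
    rw [show i + 2 = i + 1 + 1 by ring, h2 (i + 1), h1 i, h4, h6,
      circleMap_eq_circleMap_iff_exists_int hR]
    refine ⟨-m, ?_⟩
    simp only [chordAngle, halfAngle_add_int_mul_two_pi]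
    push_cast
    ring
  have hconst : ∀ i, ε i = ε 0 := by
    intro i
    obtain ⟨n, rfl⟩ := ZMod.natCast_zmod_surjective i
    induction n with
    | zero => simp
    | succ n ih => rw [Nat.cast_succ, hstep, ih]
  exact ⟨ω, ε 0, β, hω, hε 0, fun i => hconst i ▸ h1 i, fun i => hconst i ▸ h2 i, h3⟩

namespace HasTangencyAngles

variable {ω ε : ℝ} {β : ZMod N → ℝ}

lemma sideDist_eq (h : HasTangencyAngles C C' ω ε P β) (hr : 0 < C'.radius)
    (hn : dist C.center C'.center + C'.radius < C.radius) (i : ZMod N) :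
    sideDist C C' P i = C.radius * cos (chordAngle C C' (β i)) := by
  have h1 := h.center_eq
  rw [sideDist, AffineSubspace.signedInfDist_eq_signedDist_of_mem (h.tangentAt i).mem_space,
    ← (h.tangentAt i).eq_orthogonalProjection, signedDist_apply_apply, NormedSpace.normalize,
    vsub_eq_sub, vsub_eq_sub, radius_mul_cos_chordAngle hr hn, ← dist_eq_norm,
    dist_comm, mem_sphere.1 (h.tangentAt i).mem_sphere, real_inner_smul_left]
  have h2 : C'.center - circleMap C'.center C'.radius (ω + β i)
      = - circleMap 0 C'.radius (ω + β i) := by rw [← circleMap_sub_center C'.center]; ring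
  have h3 : C.center - circleMap C'.center C'.radius (ω + β i)
      = - (circleMap 0 (dist C.center C'.center) ω + circleMap 0 C'.radius (ω + β i)) := by
    rw [← circleMap_sub_center C'.center C'.radius, ← circleMap_sub_center C.center (dist _ _),
      ← h1]
    ring
  rw [h2, h3, inner_neg_neg, inner_add_right, inner_circleMap, inner_circleMap]
  have h4 : cos (ω - (ω + β i)) = cos (β i) := by rw [← cos_neg]; ring_nf
  rw [h4, sub_self, cos_zero]
  field_simp
  ring

lemma exists_int_endpoint (h : HasTangencyAngles C C' ω ε P β) (hR : C.radius ≠ 0) (i : ZMod N) :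
    ∃ m : ℤ, β i + ε * chordAngle C C' (β i)
      = β (i + 1) - ε * chordAngle C C' (β (i + 1)) + m * (2 * π) := by
  have h1 := (h.end_eq i).symm.trans (h.start_eq (i + 1))
  rw [circleMap_eq_circleMap_iff_exists_int hR] at h1
  obtain ⟨m, hm⟩ := h1
  exact ⟨m, by linarith⟩

end HasTangencyAngles

end Polygons

/-! ### Areas, angles and poles in polar form. -/

section Plane

lemma areaForm_circleMap (a b x y : ℝ) :
    Complex.orientation.areaForm (circleMap 0 a x) (circleMap 0 b y) = a * b * sin (y - x) := by
  rw [Complex.areaForm, conj_circleMap_zero, circleMap_zero_mul, circleMap_zero_im]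
  ring_nf

lemma oangle_circleMap {a b : ℝ} (ha : 0 < a) (hb : 0 < b) (x y : ℝ) :
    Complex.orientation.oangle (circleMap 0 a x) (circleMap 0 b y) = ((y - x : ℝ) : Angle) := by
  rw [Complex.oangle, conj_circleMap_zero, circleMap_zero_mul, circleMap_zero, Complex.exp_mul_I,
    ← Complex.ofReal_cos, ← Complex.ofReal_sin, ← Angle.cos_coe, ← Angle.sin_coe,
    Complex.arg_mul_cos_add_sin_mul_I_coe_angle (mul_pos ha hb)]
  congr 1
  ring

lemma circleMap_zero_add_pi_div_two (a x : ℝ) :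
    circleMap 0 a (x + π / 2) = Complex.I * circleMap 0 a x := by
  apply Complex.ext <;> simp [circleMap_zero_re, circleMap_zero_im, cos_add_pi_div_two,
    sin_add_pi_div_two]

lemma circleMap_zero_add_pi (a x : ℝ) : circleMap 0 a (x + π) = -circleMap 0 a x := by
  apply Complex.ext <;> simp [circleMap_zero_re, circleMap_zero_im, cos_add_pi, sin_add_pi]

/-- The tangents to a circle at two of its points meet in the pole of the chord. -/
lemma eq_pole {R θ k : ℝ} (hR : R ≠ 0) (hk : sin k ≠ 0) {Z : ℂ}
    (h1 : inner ℝ (Z - circleMap 0 R (θ - k)) (circleMap 0 R (θ - k)) = 0)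
    (h2 : inner ℝ (Z - circleMap 0 R (θ + k)) (circleMap 0 R (θ + k)) = 0) :
    cos k ≠ 0 ∧
      Z = circleMap 0 R (θ - k) + (tan k) • (Complex.I * circleMap 0 R (θ - k)) ∧
      Z = circleMap 0 R (θ + k) - (tan k) • (Complex.I * circleMap 0 R (θ + k)) := by
  obtain ⟨x, y⟩ := Z
  simp only [inner_sub_left, Complex.inner, Complex.mul_re, Complex.conj_re,
    Complex.conj_im, circleMap_zero_re, circleMap_zero_im, cos_sub, cos_add, sin_sub,
    sin_add] at h1 h2
  have hk2 := sin_sq_add_cos_sq k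
  have hθ2 := sin_sq_add_cos_sq θ
  -- Half the sum and half the difference of the two tangent equations give the coordinates of the
  -- pole along and across the direction `θ`.
  have e1 : (x * cos θ + y * sin θ) * cos k = R := by
    refine mul_left_cancel₀ hR ?_
    linear_combination (h1 + h2) / 2 + R ^ 2 * (sin k ^ 2 + cos k ^ 2) * hθ2 + R ^ 2 * hk2
  have e2 : y * cos θ - x * sin θ = 0 := by
    refine (mul_eq_zero.1 (?_ : (R * sin k) * (y * cos θ - x * sin θ) = 0)).resolve_left
      (mul_ne_zero hR hk)
    linear_combination (h2 - h1) / 2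
  have hc : cos k ≠ 0 := by
    intro h0
    rw [h0, mul_zero] at e1
    exact hR e1.symm
  have ex : x * cos k = R * cos θ := by
    linear_combination cos θ * e1 - sin θ * cos k * e2 - x * cos k * hθ2
  have ey : y * cos k = R * sin θ := by
    linear_combination sin θ * e1 + cos θ * cos k * e2 - y * cos k * hθ2
  refine ⟨hc, ?_, ?_⟩ <;> rw [tan_eq_sin_div_cos] <;> apply Complex.ext <;>
    simp only [Complex.add_re, Complex.add_im, Complex.sub_re, Complex.sub_im, Complex.real_smul,
      Complex.re_ofReal_mul, Complex.im_ofReal_mul, Complex.I_mul_re, Complex.I_mul_im,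
      circleMap_zero_re, circleMap_zero_im, cos_sub, cos_add, sin_sub, sin_add] <;>
    field_simp
  · linear_combination ex - R * cos θ * hk2
  · linear_combination ey - R * sin θ * hk2
  · linear_combination ex - R * cos θ * hk2
  · linear_combination ey - R * sin θ * hk2

lemma angle_smul_smul_of_mul_neg {u v : ℂ} {x y : ℝ} (h : x * y < 0) :
    InnerProductGeometry.angle (x • u) (y • v) = π - InnerProductGeometry.angle u v := by
  rcases mul_neg_iff.1 h with ⟨hx, hy⟩ | ⟨hx, hy⟩
  · rw [InnerProductGeometry.angle_smul_left_of_pos _ _ hx,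
      InnerProductGeometry.angle_smul_right_of_neg _ _ hy, InnerProductGeometry.angle_neg_right]
  · rw [InnerProductGeometry.angle_smul_left_of_neg _ _ hx,
      InnerProductGeometry.angle_smul_right_of_pos _ _ hy, InnerProductGeometry.angle_neg_left]

lemma angle_smul_smul_of_mul_pos {u v : ℂ} {x y : ℝ} (h : 0 < x * y) :
    InnerProductGeometry.angle (x • u) (y • v) = InnerProductGeometry.angle u v := by
  rcases mul_pos_iff.1 h with ⟨hx, hy⟩ | ⟨hx, hy⟩
  · rw [InnerProductGeometry.angle_smul_left_of_pos _ _ hx,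
      InnerProductGeometry.angle_smul_right_of_pos _ _ hy]
  · rw [InnerProductGeometry.angle_smul_left_of_neg _ _ hx,
      InnerProductGeometry.angle_smul_right_of_neg _ _ hy, InnerProductGeometry.angle_neg_neg]

/-- The undirected angle is `2k` folded into `[0, π]`, which loses the sign of `cos k`. -/
lemma cos_half_angle_circleMap {R : ℝ} (hR : 0 < R) (θ k : ℝ) :
    cos (InnerProductGeometry.angle (circleMap 0 R (θ - k)) (circleMap 0 R (θ + k)) / 2)
      = |cos k| := by
  have h0 := InnerProductGeometry.angle_nonneg (circleMap 0 R (θ - k)) (circleMap 0 R (θ + k))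
  have h1 := InnerProductGeometry.angle_le_pi (circleMap 0 R (θ - k)) (circleMap 0 R (θ + k))
  rw [cos_half (by linarith [pi_pos]) h1, InnerProductGeometry.cos_angle, inner_circleMap,
    norm_circleMap_zero, norm_circleMap_zero, abs_of_pos hR, mul_div_cancel_left₀ _ (by positivity),
    show θ + k - (θ - k) = 2 * k by ring, cos_two_mul, ← sqrt_sq_eq_abs]
  congr 1
  ring

end Plane

/-! ### Directed and undirected angles of the polar polygon. -/

namespace HasTangencyAngles

variable {N : ℕ} {C C' : Sphere ℂ} {P Q : ZMod N → ℂ} {ω ε : ℝ} {β : ZMod N → ℝ}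

lemma tan_sign_mul (h : HasTangencyAngles C C' ω ε P β) (x : ℝ) : tan (ε * x) = ε * tan x := by
  rcases h.sign with rfl | rfl <;> simp

lemma cos_sign_mul (h : HasTangencyAngles C C' ω ε P β) (x : ℝ) : cos (ε * x) = cos x := by
  rcases h.sign with rfl | rfl <;> simp

lemma sin_sign_mul (h : HasTangencyAngles C C' ω ε P β) (x : ℝ) : sin (ε * x) = ε * sin x := by
  rcases h.sign with rfl | rfl <;> simp

lemma sign_mul_self (h : HasTangencyAngles C C' ω ε P β) : ε * ε = 1 := by
  rcases h.sign with rfl | rfl <;> norm_num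

lemma start_sub_center (h : HasTangencyAngles C C' ω ε P β) (i : ZMod N) :
    P i - C.center = circleMap 0 C.radius (ω + β i - ε * chordAngle C C' (β i)) := by
  rw [h.start_eq, circleMap_sub_center, add_sub_assoc]

lemma end_sub_center (h : HasTangencyAngles C C' ω ε P β) (i : ZMod N) :
    P (i + 1) - C.center = circleMap 0 C.radius (ω + β i + ε * chordAngle C C' (β i)) := by
  rw [h.end_eq, circleMap_sub_center, add_assoc]

/-- Twice the area of a triangle with base `2 R sin κ` and height `r`; its sign `ε` identifies the
sense of traversal. -/
lemma areaForm_eq (h : HasTangencyAngles C C' ω ε P β) (hr : 0 < C'.radius)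
    (hn : dist C.center C'.center + C'.radius < C.radius) (i : ZMod N) :
    Complex.orientation.areaForm (P i - C'.center) (P (i + 1) - C'.center)
      = ε * (2 * C.radius * C'.radius * sin (chordAngle C C' (β i))) := by
  have h0 := radius_mul_cos_chordAngle hr hn (β i)
  have hO : C'.center - C.center = circleMap 0 (dist C.center C'.center) ω := by
    rw [← circleMap_sub_center C.center, ← h.center_eq]
  rw [← sub_sub_sub_cancel_right (P i) _ C.center,
    ← sub_sub_sub_cancel_right (P (i + 1)) _ C.center,
    h.start_sub_center, h.end_sub_center, hO]
  simp only [map_sub, LinearMap.sub_apply, areaForm_circleMap]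
  set κ := chordAngle C C' (β i)
  rw [show ω + β i + ε * κ - (ω + β i - ε * κ) = 2 * (ε * κ) by ring,
    show ω + β i + ε * κ - ω = β i + ε * κ by ring,
    show ω - (ω + β i - ε * κ) = ε * κ - β i by ring, sub_self, sin_zero, sin_two_mul, sin_add,
    sin_sub, h.cos_sign_mul, h.sin_sign_mul]
  linear_combination 2 * C.radius * ε * sin κ * h0

/-- The orientation for which the polygon turns counterclockwise around the center of `C'`. -/
lemma exists_orientation (h : HasTangencyAngles C C' ω ε P β) (hr : 0 < C'.radius)
    (hn : dist C.center C'.center + C'.radius < C.radius) :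
    ∃ o : Orientation ℝ ℂ (Fin 2), IsCounterclockwise o C' P ∧
      ∀ i, sin (directedAngle o C P i / 2) = cos (chordAngle C C' (β i)) := by
  have hR : 0 < C.radius := by linarith [dist_nonneg (x := C.center) (y := C'.center)]
  have key : ∀ i, ∀ o : Orientation ℝ ℂ (Fin 2),
      o.oangle (tangentDir o C (P (i + 1))) (-tangentDir o C (P i))
        = ((π - 2 * chordAngle C C' (β i) : ℝ) : Angle) →
      sin (directedAngle o C P i / 2) = cos (chordAngle C C' (β i)) := by
    intro i o ho
    have h1 := halfAngle_pos hr dist_nonneg hn (β i)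
    have h2 := halfAngle_lt_pi hr dist_nonneg hn (β i)
    rw [directedAngle, ho, Angle.toReal_coe_eq_self_iff.2, ← cos_pi_div_two_sub]
    · congr 1; ring
    · rw [chordAngle]; constructor <;> linarith
  have key2 : ∀ i, Complex.orientation.oangle (tangentDir Complex.orientation C (P (i + 1)))
      (-tangentDir Complex.orientation C (P i))
      = ((π - 2 * (ε * chordAngle C C' (β i)) : ℝ) : Angle) := by
    intro i
    rw [tangentDir, tangentDir, Complex.rightAngleRotation, Complex.rightAngleRotation,
      h.end_sub_center, h.start_sub_center, ← circleMap_zero_add_pi_div_two,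
      ← circleMap_zero_add_pi_div_two, ← circleMap_zero_add_pi, oangle_circleMap hR hR]
    congr 1
    ring
  have hpos : ∀ i, 0 < 2 * C.radius * C'.radius * sin (chordAngle C C' (β i)) := fun i =>
    mul_pos (by positivity) (sin_chordAngle_pos hr hn _)
  rcases h.sign with hε | hε
  · refine ⟨Complex.orientation, fun i => ?_, fun i => key i _ ?_⟩
    · rw [h.areaForm_eq hr hn, hε, one_mul]
      exact hpos i
    · rw [key2, hε, one_mul]
  · refine ⟨-Complex.orientation, fun i => ?_, fun i => key i _ ?_⟩
    · rw [Orientation.areaForm_neg_orientation, LinearMap.neg_apply, LinearMap.neg_apply,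
        h.areaForm_eq hr hn, hε, neg_one_mul, neg_neg]
      exact hpos i
    · rw [tangentDir, tangentDir, Orientation.rightAngleRotation_neg_orientation,
        Orientation.rightAngleRotation_neg_orientation, Orientation.oangle_neg_orientation_eq_neg,
        Orientation.oangle_neg_neg]
      have := key2 i
      rw [tangentDir, tangentDir, hε] at this
      rw [this, ← Angle.coe_neg, Angle.angle_eq_iff_two_pi_dvd_sub]
      -- With the sense reversed the angle is `-(π + 2κ)`, which is `π - 2κ` minus one full turn.
      exact ⟨-1, by push_cast; ring⟩

lemma polar_eq (h : HasTangencyAngles C C' ω ε P β) (hr : 0 < C'.radius)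
    (hn : dist C.center C'.center + C'.radius < C.radius) (hQ : IsPolarPolygon C P Q)
    (i : ZMod N) :
    cos (chordAngle C C' (β i)) ≠ 0 ∧
      Q i = P i + (ε * tan (chordAngle C C' (β i))) • (Complex.I * (P i - C.center)) ∧
      Q i = P (i + 1)
        - (ε * tan (chordAngle C C' (β i))) • (Complex.I * (P (i + 1) - C.center)) := by
  have hR : C.radius ≠ 0 := by linarith [dist_nonneg (x := C.center) (y := C'.center)]
  have hs : sin (ε * chordAngle C C' (β i)) ≠ 0 := by
    rw [h.sin_sign_mul]
    exact mul_ne_zero (by rcases h.sign with rfl | rfl <;> norm_num)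
      (sin_chordAngle_pos hr hn _).ne'
  obtain ⟨h1, h2⟩ := hQ i
  rw [Sphere.mem_orthRadius_iff_inner_left, vsub_eq_sub, vsub_eq_sub,
    ← sub_sub_sub_cancel_right _ _ C.center] at h1 h2
  rw [h.start_sub_center] at h1
  rw [h.end_sub_center] at h2
  have h3 := eq_pole hR hs h1 h2
  rw [h.cos_sign_mul, h.tan_sign_mul, ← h.start_sub_center, ← h.end_sub_center] at h3
  refine ⟨h3.1, ?_, ?_⟩
  · linear_combination h3.2.1
  · linear_combination h3.2.2

/-- Both neighbours of `Q i` lie on the tangents through it, so the arms are multiples of the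
tangent directions at `P i` and `P (i + 1)`. Only the signs of the coefficients matter: opposite
signs give the supplement of the central angle, equal signs the central angle itself. -/
lemma vertexAngle_eq (h : HasTangencyAngles C C' ω ε P β) (hr : 0 < C'.radius)
    (hn : dist C.center C'.center + C'.radius < C.radius) (hQ : IsPolarPolygon C P Q)
    (i : ZMod N) :
    vertexAngle Q i = InnerProductGeometry.angle
      ((-(ε * (tan (chordAngle C C' (β (i - 1))) + tan (chordAngle C C' (β i)))))
        • (Complex.I * (P i - C.center)))
      ((ε * (tan (chordAngle C C' (β i)) + tan (chordAngle C C' (β (i + 1)))))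
        • (Complex.I * (P (i + 1) - C.center))) := by
  have h0 := (h.polar_eq hr hn hQ (i - 1)).2.2
  have h1 := (h.polar_eq hr hn hQ i).2
  have h2 := (h.polar_eq hr hn hQ (i + 1)).2.1
  rw [sub_add_cancel] at h0
  rw [vertexAngle, EuclideanGeometry.angle, vsub_eq_sub, vsub_eq_sub]
  congr 1
  · nth_rw 1 [h0, h1.1]
    module
  · nth_rw 1 [h2, h1.2]
    module

lemma cos_half_angle_vertices (h : HasTangencyAngles C C' ω ε P β) (hR : 0 < C.radius)
    (i : ZMod N) :
    cos (InnerProductGeometry.angle (Complex.I * (P i - C.center))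
      (Complex.I * (P (i + 1) - C.center)) / 2) = |cos (chordAngle C C' (β i))| := by
  rw [Complex.angle_mul_left Complex.I_ne_zero, h.start_sub_center, h.end_sub_center,
    cos_half_angle_circleMap hR, h.cos_sign_mul]

lemma sin_half_vertexAngle (h : HasTangencyAngles C C' ω ε P β) (hr : 0 < C'.radius)
    (hn : dist C.center C'.center + C'.radius < C.radius) (hQ : IsPolarPolygon C P Q)
    {i : ZMod N} (hi : 0 < (tan (chordAngle C C' (β (i - 1))) + tan (chordAngle C C' (β i)))
      * (tan (chordAngle C C' (β i)) + tan (chordAngle C C' (β (i + 1))))) :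
    sin (vertexAngle Q i / 2) = |cos (chordAngle C C' (β i))| := by
  have hR : 0 < C.radius := by linarith [dist_nonneg (x := C.center) (y := C'.center)]
  rw [h.vertexAngle_eq hr hn hQ, angle_smul_smul_of_mul_neg, ← h.cos_half_angle_vertices hR,
    ← cos_pi_div_two_sub]
  · congr 1; ring
  · have := h.sign_mul_self
    linear_combination hi - (tan (chordAngle C C' (β (i - 1))) + tan (chordAngle C C' (β i)))
      * (tan (chordAngle C C' (β i)) + tan (chordAngle C C' (β (i + 1)))) * this

lemma cos_half_vertexAngle (h : HasTangencyAngles C C' ω ε P β) (hr : 0 < C'.radius)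
    (hn : dist C.center C'.center + C'.radius < C.radius) (hQ : IsPolarPolygon C P Q)
    {i : ZMod N} (hi : (tan (chordAngle C C' (β (i - 1))) + tan (chordAngle C C' (β i)))
      * (tan (chordAngle C C' (β i)) + tan (chordAngle C C' (β (i + 1)))) < 0) :
    cos (vertexAngle Q i / 2) = |cos (chordAngle C C' (β i))| := by
  have hR : 0 < C.radius := by linarith [dist_nonneg (x := C.center) (y := C'.center)]
  rw [h.vertexAngle_eq hr hn hQ, angle_smul_smul_of_mul_pos, h.cos_half_angle_vertices hR]
  have := h.sign_mul_self
  linear_combination hi + (tan (chordAngle C C' (β (i - 1))) + tan (chordAngle C C' (β i)))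
      * (tan (chordAngle C C' (β i)) + tan (chordAngle C C' (β (i + 1)))) * this

/-- A point of `C` on the same side of the `i`-th side as the center of `C'`. -/
lemma cos_lt_of_sSameSide (h : HasTangencyAngles C C' ω ε P β) (hr : 0 < C'.radius)
    (hn : dist C.center C'.center + C'.radius < C.radius) {i : ZMod N} {φ : ℝ}
    (hs : (line[ℝ, P i, P (i + 1)]).SSameSide C'.center
      (circleMap C.center C.radius (ω + φ))) :
    cos (φ - β i) < cos (chordAngle C C' (β i)) := by
  have hR : 0 < C.radius := by linarith [dist_nonneg (x := C.center) (y := C'.center)]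
  obtain ⟨⟨p, hp, q, hq, hray⟩, hO, hX⟩ := hs
  have hT := h.tangentAt i
  have h1 := inner_sub_tangencyPoint h.center_eq (β i) φ
  rw [← radius_mul_cos_chordAngle hr hn, ← mul_sub] at h1
  set T := circleMap C'.center C'.radius (ω + β i) with hTdef
  set X := circleMap C.center C.radius (ω + φ)
  obtain ⟨a, b, ha, hb, hab⟩ := hray.exists_pos (fun h0 => hO (vsub_eq_zero_iff_eq.1 h0 ▸ hp))
    (fun h0 => hX (vsub_eq_zero_iff_eq.1 h0 ▸ hq))
  have hp0 := hT.inner_left_eq_zero_of_mem hp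
  have hq0 := hT.inner_left_eq_zero_of_mem hq
  have hTT : inner ℝ (T - C'.center) (T - C'.center) = C'.radius ^ 2 := by
    rw [hTdef, circleMap_sub_center, inner_circleMap, sub_self, cos_zero]; ring
  have h2 : inner ℝ (C'.center - p) (T - C'.center) = -C'.radius ^ 2 := by
    rw [vsub_eq_sub, vsub_eq_sub] at hp0
    rw [show C'.center - p = -((p - T) + (T - C'.center)) by ring, inner_neg_left, inner_add_left,
      hp0, hTT, zero_add]
  have h3 : inner ℝ (X - q) (T - C'.center) = inner ℝ (X - T) (T - C'.center) := by
    rw [vsub_eq_sub, vsub_eq_sub] at hq0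
    rw [show X - q = (X - T) - (q - T) by ring, inner_sub_left, hq0, sub_zero]
  -- Pairing the ray condition with the outward normal `T - C'.center` removes the arbitrary points
  -- `p`, `q` of the line and compares signs.
  have h4 := congrArg (fun z => inner ℝ z (T - C'.center)) hab
  simp only [vsub_eq_sub, real_inner_smul_left, h2, h3, h1] at h4
  by_contra! hcon
  have h5 : 0 ≤ b * (C'.radius * (C.radius
      * (cos (φ - β i) - cos (chordAngle C C' (β i))))) := by
    have := sub_nonneg.2 hcon
    positivity
  have h6 : 0 < a * C'.radius ^ 2 := by positivity
  linarith

end HasTangencyAngles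

lemma one_ne_zero_of_three_le {N : ℕ} (hN : 3 ≤ N) : (1 : ZMod N) ≠ 0 := fun h => by
  have := (ZMod.natCast_eq_zero_iff 1 N).1 (by exact_mod_cast h)
  have := Nat.le_of_dvd one_pos this
  omega

lemma two_ne_zero_of_three_le {N : ℕ} (hN : 3 ≤ N) : (2 : ZMod N) ≠ 0 := fun h => by
  have := (ZMod.natCast_eq_zero_iff 2 N).1 (by exact_mod_cast h)
  have := Nat.le_of_dvd two_pos this
  omega

lemma tan_add_tan {x y : ℝ} (hx : cos x ≠ 0) (hy : cos y ≠ 0) :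
    tan x + tan y = sin (x + y) / (cos x * cos y) := by
  rw [tan_eq_sin_div_cos, tan_eq_sin_div_cos, sin_add]
  field_simp

/-! ### Convex polygons and the sums of undirected angles. -/

namespace HasTangencyAngles

variable {N : ℕ} {C C' : Sphere ℂ} {P Q : ZMod N → ℂ} {ω ε : ℝ} {β : ZMod N → ℝ}

lemma tan_chordAngle_pos (hr : 0 < C'.radius)
    (hn : dist C.center C'.center + C'.radius < C.radius) {β : ℝ}
    (hc : 0 < cos (chordAngle C C' β)) : 0 < tan (chordAngle C C' β) := by
  rw [tan_eq_sin_div_cos]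
  exact div_pos (sin_chordAngle_pos hr hn β) hc

/-- Two adjacent sides of a convex polygon cut off less than the whole circle. -/
lemma sin_add_pos_of_isConvexAround (h : HasTangencyAngles C C' ω ε P β) (hN : 3 ≤ N)
    (hr : 0 < C'.radius) (hn : dist C.center C'.center + C'.radius < C.radius)
    (hP : IsConvexAround C' P) (k : ZMod N) :
    0 < sin (chordAngle C C' (β k) + chordAngle C C' (β (k + 1))) := by
  have h1 := h.cos_lt_of_sSameSide hr hn (i := k)
    (φ := β (k + 1) + ε * chordAngle C C' (β (k + 1))) (by
      rw [← h.end_eq]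
      refine hP k (k + 1 + 1) (fun e => two_ne_zero_of_three_le hN ?_)
        (fun e => one_ne_zero_of_three_le hN ?_) <;> linear_combination e)
  have hR : C.radius ≠ 0 := by linarith [dist_nonneg (x := C.center) (y := C'.center)]
  obtain ⟨m, hm⟩ := h.exists_int_endpoint hR k
  have hs := sin_chordAngle_pos hr hn (β (k + 1))
  set x := chordAngle C C' (β k)
  set y := chordAngle C C' (β (k + 1))
  -- Seen from `β k`, the vertex `P (k + 2)` is at `ε (x + 2y)` modulo full turns, and `cos (x + 2y)
  -- < cos x` means `0 < sin (x + y) sin y`.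
  rw [show β (k + 1) + ε * y - β k = ε * (x + y + y) - m * (2 * π) by linarith,
    cos_sub_int_mul_two_pi, h.cos_sign_mul, cos_add, show x = x + y - y by ring, cos_sub,
    sub_add_cancel] at h1
  by_contra! hcon
  nlinarith

/-- Both endpoints of side `j` lie on the inner side of line `k`; adding the two inequalities gives
`key`, which also holds with the roles exchanged. If both cosines were nonpositive, each would be
smaller than the other. -/
lemma cos_pos_of_not_adjacent (h : HasTangencyAngles C C' ω ε P β)
    (hr : 0 < C'.radius) (hn : dist C.center C'.center + C'.radius < C.radius)
    (hP : IsConvexAround C' P) {k j : ZMod N} (hk : cos (chordAngle C C' (β k)) < 0)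
    (h1 : j ≠ k) (h2 : j ≠ k + 1) (h3 : k ≠ j + 1) : 0 < cos (chordAngle C C' (β j)) := by
  have key : ∀ k j : ZMod N, j ≠ k → j ≠ k + 1 → k ≠ j + 1 →
      cos (β j - β k) * cos (chordAngle C C' (β j)) < cos (chordAngle C C' (β k)) := by
    intro k j h1 h2 h3
    have e1 := h.cos_lt_of_sSameSide hr hn (i := k)
      (φ := β j - ε * chordAngle C C' (β j)) (by rw [← h.start_eq]; exact hP k j h1 h2)
    have e2 := h.cos_lt_of_sSameSide hr hn (i := k)
      (φ := β j + ε * chordAngle C C' (β j)) (by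
        rw [← h.end_eq]; exact hP k (j + 1) h3.symm (fun e => h1 (add_right_cancel e)))
    rw [sub_right_comm, cos_sub, h.cos_sign_mul] at e1
    rw [add_sub_right_comm, cos_add, h.cos_sign_mul] at e2
    linarith
  have e1 := key k j h1 h2 h3
  have e2 := key j k h1.symm h3 h2
  rw [← cos_neg, neg_sub] at e2
  by_contra! hcon
  have h4 := cos_le_one (β j - β k)
  nlinarith

/-- In a convex polygon the center of `C` is on the outer side of at most one side. -/
lemma cos_pos_of_ne (h : HasTangencyAngles C C' ω ε P β) (hN : 3 ≤ N)
    (hr : 0 < C'.radius) (hn : dist C.center C'.center + C'.radius < C.radius)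
    (hP : IsConvexAround C' P) {k j : ZMod N} (hk : cos (chordAngle C C' (β k)) < 0)
    (hj : j ≠ k) : 0 < cos (chordAngle C C' (β j)) := by
  have hsk := sin_chordAngle_pos hr hn (β k)
  have hsj := sin_chordAngle_pos hr hn (β j)
  by_cases h2 : j = k + 1
  · subst h2
    have := h.sin_add_pos_of_isConvexAround hN hr hn hP k
    rw [sin_add] at this
    by_contra! hcon
    nlinarith
  by_cases h3 : k = j + 1
  · subst h3
    have := h.sin_add_pos_of_isConvexAround hN hr hn hP j
    rw [sin_add] at this
    by_contra! hcon
    nlinarith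
  exact h.cos_pos_of_not_adjacent hr hn hP hk hj h2 h3

lemma sum_sin_half_vertexAngle (h : HasTangencyAngles C C' ω ε P β) [NeZero N]
    (hr : 0 < C'.radius) (hn : dist C.center C'.center + C'.radius < C.radius)
    (hQ : IsPolarPolygon C P Q) (hpos : ∀ i, 0 < cos (chordAngle C C' (β i))) :
    ∑ i, sin (vertexAngle Q i / 2) = ∑ i, cos (chordAngle C C' (β i)) := by
  refine Finset.sum_congr rfl fun i _ => ?_
  have ht := fun i => tan_chordAngle_pos hr hn (hpos i)
  rw [h.sin_half_vertexAngle hr hn hQ (mul_pos (add_pos (ht _) (ht _)) (add_pos (ht _) (ht _))),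
    abs_of_pos (hpos i)]

/-- The sums of consecutive tangents are negative exactly for the two pairs containing `k`. Their
products are thus positive at `k`, negative at `k - 1` and `k + 1`, and positive elsewhere. Sine is
therefore exchanged for cosine at the two neighbours only, while at `k` the absolute value produces
the minus sign. -/
lemma sum_half_vertexAngle_of_neg (h : HasTangencyAngles C C' ω ε P β) [NeZero N] (hN : 3 ≤ N)
    (hr : 0 < C'.radius) (hn : dist C.center C'.center + C'.radius < C.radius)
    (hP : IsConvexAround C' P) (hQ : IsPolarPolygon C P Q) {k : ZMod N}
    (hk : cos (chordAngle C C' (β k)) < 0) :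
    (∑ i ∈ Finset.univ \ {k - 1, k, k + 1}, sin (vertexAngle Q i / 2))
      + cos (vertexAngle Q (k - 1) / 2) - sin (vertexAngle Q k / 2)
      + cos (vertexAngle Q (k + 1) / 2) = ∑ i, cos (chordAngle C C' (β i)) := by
  have one_ne := one_ne_zero_of_three_le hN
  have two_ne := two_ne_zero_of_three_le hN
  have hc : ∀ i, i ≠ k → 0 < cos (chordAngle C C' (β i)) :=
    fun i hi => h.cos_pos_of_ne hN hr hn hP hk hi
  have ht : ∀ i, i ≠ k → 0 < tan (chordAngle C C' (β i)) :=
    fun i hi => tan_chordAngle_pos hr hn (hc i hi)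
  have n1 : k - 1 ≠ k := fun e => one_ne (by linear_combination -e)
  have n2 : k + 1 ≠ k := fun e => one_ne (by linear_combination e)
  have n3 : k - 1 ≠ k + 1 := fun e => two_ne (by linear_combination -e)
  have n4 : k - 1 - 1 ≠ k := fun e => two_ne (by linear_combination -e)
  have n5 : k + 1 + 1 ≠ k := fun e => two_ne (by linear_combination e)
  have tR : tan (chordAngle C C' (β k)) + tan (chordAngle C C' (β (k + 1))) < 0 := by
    rw [tan_add_tan hk.ne (hc _ n2).ne']
    exact div_neg_of_pos_of_neg (h.sin_add_pos_of_isConvexAround hN hr hn hP k)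
      (mul_neg_of_neg_of_pos hk (hc _ n2))
  have tL : tan (chordAngle C C' (β (k - 1))) + tan (chordAngle C C' (β k)) < 0 := by
    rw [tan_add_tan (hc _ n1).ne' hk.ne]
    have := h.sin_add_pos_of_isConvexAround hN hr hn hP (k - 1)
    rw [sub_add_cancel] at this
    exact div_neg_of_pos_of_neg this (mul_neg_of_pos_of_neg (hc _ n1) hk)
  have e0 : sin (vertexAngle Q k / 2) = -cos (chordAngle C C' (β k)) := by
    rw [h.sin_half_vertexAngle hr hn hQ (mul_pos_of_neg_of_neg tL tR), abs_of_neg hk]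
  have e1 : cos (vertexAngle Q (k - 1) / 2) = cos (chordAngle C C' (β (k - 1))) := by
    rw [h.cos_half_vertexAngle hr hn hQ, abs_of_pos (hc _ n1)]
    rw [sub_add_cancel]
    exact mul_neg_of_pos_of_neg (add_pos (ht _ n4) (ht _ n1)) tL
  have e2 : cos (vertexAngle Q (k + 1) / 2) = cos (chordAngle C C' (β (k + 1))) := by
    rw [h.cos_half_vertexAngle hr hn hQ, abs_of_pos (hc _ n2)]
    rw [add_sub_cancel_right]
    exact mul_neg_of_neg_of_pos tR (add_pos (ht _ n2) (ht _ n5))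
  have e3 : ∑ i ∈ Finset.univ \ {k - 1, k, k + 1}, sin (vertexAngle Q i / 2)
      = ∑ i ∈ Finset.univ \ {k - 1, k, k + 1}, cos (chordAngle C C' (β i)) := by
    refine Finset.sum_congr rfl fun i hi => ?_
    simp only [Finset.mem_sdiff, Finset.mem_univ, true_and, Finset.mem_insert,
      Finset.mem_singleton, not_or] at hi
    obtain ⟨i1, i2, i3⟩ := hi
    have i4 : i - 1 ≠ k := fun e => i3 (by linear_combination e)
    have i5 : i + 1 ≠ k := fun e => i1 (by linear_combination e)
    rw [h.sin_half_vertexAngle hr hn hQ (mul_pos (add_pos (ht _ i4) (ht _ i2))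
      (add_pos (ht _ i2) (ht _ i5))), abs_of_pos (hc i i2)]
  rw [e0, e1, e2, e3, ← Finset.sum_sdiff (Finset.subset_univ {k - 1, k, k + 1}),
    Finset.sum_insert (by simp [n1, n3]), Finset.sum_insert (by simpa using n2.symm),
    Finset.sum_singleton]
  ring

end HasTangencyAngles

/-! ### Poles, polars and the parabola. -/

section Parabola

lemma infDist_setOf_inner_eq (O X : ℂ) {w : ℂ} (hw : w ≠ 0) (a : ℝ) :
    Metric.infDist X {y | inner ℝ (y - O) w = a} = |inner ℝ (X - O) w - a| / ‖w‖ := by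
  have hw' : 0 < ‖w‖ := norm_pos_iff.2 hw
  -- The witness is the foot of the perpendicular from `X`.
  have hmem : X - ((inner ℝ (X - O) w - a) / ‖w‖ ^ 2) • w ∈ {y | inner ℝ (y - O) w = a} := by
    rw [Set.mem_ofPred_eq, sub_right_comm, inner_sub_left, real_inner_smul_left,
      real_inner_self_eq_norm_sq]
    field_simp
    ring
  refine le_antisymm ((Metric.infDist_le_dist_of_mem hmem).trans_eq ?_)
    ((Metric.le_infDist ⟨_, hmem⟩).2 fun {y} hy => ?_)
  · rw [dist_eq_norm, sub_sub_cancel, norm_smul, norm_eq_abs, abs_div, abs_of_pos (pow_pos hw' 2)]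
    field_simp
  · rw [div_le_iff₀ hw', dist_eq_norm]
    have h1 : inner ℝ (X - O) w - a = inner ℝ (X - y) w := by
      rw [← (show _ = a from hy), ← inner_sub_left, sub_sub_sub_cancel_right]
    rw [h1]
    exact abs_real_inner_le_norm _ _

lemma coe_line_eq_setOf_inner_eq {O X Y w : ℂ} {a : ℝ} (hw : w ≠ 0) (hXY : Y ≠ X)
    (hX : inner ℝ (X - O) w = a) (hY : inner ℝ (Y - O) w = a) :
    (line[ℝ, X, Y] : Set ℂ) = {y | inner ℝ (y - O) w = a} := by
  have hv : inner ℝ (Y - X) w = 0 := by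
    rw [← sub_sub_sub_cancel_right Y X O, inner_sub_left, hX, hY, sub_self]
  ext Z
  rw [SetLike.mem_coe, mem_affineSpan_pair_iff_exists_lineMap_eq, Set.mem_ofPred_eq]
  constructor
  · rintro ⟨t, rfl⟩
    rw [AffineMap.lineMap_apply, vsub_eq_sub, vadd_eq_add, add_sub_assoc, inner_add_left,
      real_inner_smul_left, hv, hX]
    ring
  · intro hZ
    have hZ' : inner ℝ (Z - X) w = 0 := by
      rw [← sub_sub_sub_cancel_right Z X O, inner_sub_left, hX, hZ, sub_self]
    have hd : Y - X ≠ 0 := sub_ne_zero.2 hXY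
    have hd' := Complex.normSq_pos.2 hd
    refine ⟨inner ℝ (Z - X) (Y - X) / Complex.normSq (Y - X), ?_⟩
    rw [AffineMap.lineMap_apply, vsub_eq_sub, vadd_eq_add, ← eq_sub_iff_add_eq]
    generalize Y - X = d at *
    generalize Z - X = z at *
    obtain ⟨p, q⟩ := d
    obtain ⟨x, y⟩ := z
    obtain ⟨u, v⟩ := w
    simp only [Complex.inner, Complex.mul_re, Complex.conj_re, Complex.conj_im,
      Complex.normSq_mk] at hv hZ' hd' ⊢
    -- Two plane vectors orthogonal to the same nonzero `w` are parallel.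
    have hdet : x * q = y * p := by
      by_cases hu : u = 0
      · have hv0 : v ≠ 0 := by rintro rfl; exact hw (by rw [hu]; rfl)
        refine mul_right_cancel₀ hv0 ?_
        linear_combination x * hv - p * hZ'
      · refine mul_right_cancel₀ hu ?_
        linear_combination q * hZ' - y * hv
    apply Complex.ext <;>
      simp only [Complex.real_smul, Complex.re_ofReal_mul, Complex.im_ofReal_mul] <;>
      rw [div_mul_eq_mul_div, div_eq_iff hd'.ne']
    · linear_combination -q * hdet
    · linear_combination p * hdet

variable {N : ℕ} {C C' : Sphere ℂ} {P Q : ZMod N → ℂ}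

/-- Let `O`, `O'` be the centers and `A = |⟨Q i - O, O' - O⟩ - R²|`. The side is the polar of `Q i`,
at distance `A / |Q i - O|` from `O'`; the polar of `O'` is at distance `A / |O' - O|` from `Q i`.
As `|O' - O| = r`, tangency and the focus-directrix condition both read `A = r |Q i - O|`. -/
lemma IsPolarPolygon.isTangent_iff_mem_parabola (hQ : IsPolarPolygon C P Q)
    (hP : IsInscribed C P) (hr : 0 < C'.radius) (hR : C.radius ≠ 0) (hO : C.center ∈ C')
    (i : ZMod N) : C'.IsTangent line[ℝ, P i, P (i + 1)] ↔
      Q i ∈ parabola C.center (polarLine C C'.center) := by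
  have hin : ∀ X, X ∈ C → Q i ∈ C.orthRadius X →
      inner ℝ (X - C.center) (Q i - C.center) = C.radius ^ 2 := by
    intro X hX hQX
    rw [Sphere.mem_orthRadius_iff_inner_right, vsub_eq_sub, vsub_eq_sub] at hQX
    rw [mem_sphere, dist_eq_norm] at hX
    rw [← sub_add_sub_cancel (Q i) X, inner_add_right, hQX, real_inner_self_eq_norm_sq, hX,
      zero_add]
  have h1 := hin _ (hP.mem i) (hQ i).1
  have h2 := hin _ (hP.mem (i + 1)) (hQ i).2
  have hq : Q i - C.center ≠ 0 := by
    intro h0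
    rw [h0, inner_zero_right] at h1
    exact pow_ne_zero 2 hR h1.symm
  have hw : ‖C'.center - C.center‖ = C'.radius := by
    rw [mem_sphere, dist_comm, dist_eq_norm] at hO
    exact hO
  have hw0 : C'.center - C.center ≠ 0 := norm_pos_iff.1 (hw ▸ hr)
  rw [← Sphere.infDist_eq_radius_iff_isTangent,
    coe_line_eq_setOf_inner_eq hq (hP.ne i) h1 h2, infDist_setOf_inner_eq _ _ hq, parabola,
    Set.mem_ofPred_eq, polarLine, infDist_setOf_inner_eq _ _ hw0, hw, dist_eq_norm,
    real_inner_comm (Q i - C.center), div_eq_iff (norm_ne_zero_iff.2 hq), eq_div_iff hr.ne',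
    mul_comm, eq_comm]

end Parabola

end Bicentric

end

theorem mainTheorem1 (N : ℕ) [NeZero N] (hN : 3 ≤ N) (C C' : EuclideanGeometry.Sphere ℂ)
    (hr : 0 < C'.radius) (hnested : dist C.center C'.center + C'.radius < C.radius) :
    -- over the whole family, the sums are equal to one and the same constant `c`
    (∃ c : ℝ, ∀ P : ZMod N → ℂ, Bicentric.IsBicentric C C' P →
      (1 / C.radius) * ∑ i, Bicentric.sideDist C C' P i = c ∧
      (∃ o : Orientation ℝ ℂ (Fin 2), Bicentric.IsCounterclockwise o C' P ∧
        ∑ i, Real.sin (Bicentric.directedAngle o C P i / 2) = c) ∧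
      -- the same sum in terms of the undirected angles of the polar polygon,
      -- if the circumcenter is on the inner side of all sides of `P` ...
      (∀ Q : ZMod N → ℂ, Bicentric.IsPolarPolygon C P Q →
        (∀ i, 0 < Bicentric.sideDist C C' P i) →
        ∑ i, Real.sin (Bicentric.vertexAngle Q i / 2) = c) ∧
      -- ... and if `P` is convex and the circumcenter is on the outer side of its `k`-th side
      (∀ Q : ZMod N → ℂ, Bicentric.IsPolarPolygon C P Q → Bicentric.IsConvexAround C' P →
        ∀ k, Bicentric.sideDist C C' P k < 0 →
        (∑ i ∈ Finset.univ \ {k - 1, k, k + 1}, Real.sin (Bicentric.vertexAngle Q i / 2))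
          + Real.cos (Bicentric.vertexAngle Q (k - 1) / 2)
          - Real.sin (Bicentric.vertexAngle Q k / 2)
          + Real.cos (Bicentric.vertexAngle Q (k + 1) / 2) = c)) ∧
    -- if the circumcenter lies on the incircle, the polar family is the family of polygons
    -- circumscribed about `C` and inscribed in a parabola with focus at the center of `C`
    (C.center ∈ C' → ∀ P Q : ZMod N → ℂ, Bicentric.IsInscribed C P →
      Bicentric.IsPolarPolygon C P Q →
      (Bicentric.IsBicentric C C' P ↔
        ∀ i, Q i ∈ Bicentric.parabola C.center (Bicentric.polarLine C C'.center))) := by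
  have hR : 0 < C.radius := by linarith [dist_nonneg (x := C.center) (y := C'.center)]
  constructor
  · obtain ⟨c, hc⟩ := Bicentric.exists_sum_cos_halfAngle (N := N) hr dist_nonneg hnested
    refine ⟨c, fun P hP => ?_⟩
    obtain ⟨ω, ε, β, h⟩ := hP.exists_hasTangencyAngles hr hnested
    have hsum : ∑ i, Real.cos (Bicentric.chordAngle C C' (β i)) = c :=
      hc ε h.sign β (h.exists_int_endpoint hR.ne')
    have hd := h.sideDist_eq hr hnested
    refine ⟨?_, ?_, fun Q hQ hpos => ?_, fun Q hQ hconv k hk => ?_⟩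
    · rw [Finset.sum_congr rfl fun i _ => hd i, ← Finset.mul_sum, hsum, one_div,
        inv_mul_cancel_left₀ hR.ne']
    · obtain ⟨o, ho, hθ⟩ := h.exists_orientation hr hnested
      exact ⟨o, ho, by rw [Finset.sum_congr rfl fun i _ => hθ i, hsum]⟩
    · rw [h.sum_sin_half_vertexAngle hr hnested hQ fun i =>
        (pos_iff_pos_of_mul_pos (hd i ▸ hpos i)).1 hR, hsum]
    · rw [h.sum_half_vertexAngle_of_neg hN hr hnested hconv hQ
        (by rw [hd] at hk; exact neg_of_mul_neg_right hk hR.le), hsum]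
  · intro hO P Q hP hQ
    have key := hQ.isTangent_iff_mem_parabola hP hr hR.ne' hO
    exact ⟨fun h i => (key i).1 (h.tangent i), fun h => ⟨hP, fun i => (key i).2 (h i)⟩⟩
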